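/- Let $N\ge 1$, let $\mathcal E_1\le\dots\le\mathcal E_N$ be real numbers (energy levels) with $\sum_k\mathcal E_k=0$, let $A=-i\,\mathrm{diag}(\mathcal E_1,\dots,\mathcal E_N)$, and let $B=(b_{ij})\in\mathfrak{su}(N)$ (the traceless skew-Hermitian complex $N\times N$ matrices). Consider the control system on $SU(N)$ $$\dot X(t)=(A+u(t)B)X(t),\qquad X(0)=I,$$ with real-valued piecewise constant inputs $u$. It is called controllable if for every $\bar X\in SU(N)$ there are a time $T\ge 0$ and an input $u$ whose solution satisfies $X(T)=\bar X$. Let $\mathcal G_B$ be the graph on $\{1,\dots,N\}$ in which $i\ne j$ are joined exactly when $b_{ij}\neq 0$, let $B_0=\mathrm{diag}(b_{11},\dots,b_{NN})$ be the diagonal part of $B$, and let $C=[A,B]=(c_{ij})$. For a diagonal matrix $D=\mathrm{diag}(d_1,\dots,d_N)$ put $\alpha_{ij}(D)=d_i-d_j$. Call $D$ regular if $\alpha_{ij}(D)\neq\alpha_{kl}(D)$ whenever $i\ne j$, $k\ne l$ and $(i,j)\neq(k,l)$; call $D$ $C$-regular if the numbers $\alpha_{ij}(D)$, for the pairs $i<j$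 with $c_{ij}\neq 0$, are nonzero and pairwise distinct (that is, distinct pairs give distinct numbers). Theorem. Suppose that $\mathcal E_i\ne\mathcal E_j$ for $i\neq j$ and that $\mathcal G_B$ is connected. Then either of the following conditions is sufficient for controllability of the system: (1) $B_0$ is regular; (2) $B_0$ is $C$-regular. -/

import Mathlib

open scoped Matrix Topology

/-- The real Lie algebra `su(N)`: traceless skew-Hermitian complex `N × N` matrices. -/
def su (N : ℕ) : Set (Matrix (Fin N) (Fin N) ℂ) :=
  {M | Mᴴ = -M ∧ M.trace = 0}

/-- The drift `A = -i H₀` of the system with energy levels `E₁, …, E_N`, where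
`H₀ = diag(E₁, …, E_N)` is the internal Hamiltonian. -/
noncomputable def drift {N : ℕ} (E : Fin N → ℝ) : Matrix (Fin N) (Fin N) ℂ :=
  (-Complex.I) • Matrix.diagonal (fun k => (E k : ℂ))

/-- The diagonal part `B₀` of a matrix `B`. -/
def diagPart {N : ℕ} (B : Matrix (Fin N) (Fin N) ℂ) : Matrix (Fin N) (Fin N) ℂ :=
  Matrix.diagonal (fun k => B k k)

/-- The graph of a square matrix `M` (loops dropped): `i` and `j` are joined when `i ≠ j` and
`M i j ≠ 0` or `M j i ≠ 0`. For a skew-Hermitian matrix these two conditions are equivalent, so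
that connectivity and strong connectivity (of the directed graph) coincide. -/
def matrixGraph {N : ℕ} (M : Matrix (Fin N) (Fin N) ℂ) : SimpleGraph (Fin N) :=
  SimpleGraph.fromRel (fun i j => M i j ≠ 0)

/-- The value at the diagonal matrix `D` of the root `α_{ij} = α_i - α_j`. The root is positive
when `i < j`. -/
def rootValue {N : ℕ} (i j : Fin N) (D : Matrix (Fin N) (Fin N) ℂ) : ℂ :=
  D i i - D j j

/-- A diagonal matrix `D` is regular when all roots take pairwise distinct values at `D`.
As `α_{ji} = -α_{ij}`, no root vanishes at a regular element. -/
def IsRegularDiag {N : ℕ} (D : Matrix (Fin N) (Fin N) ℂ) : Prop :=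
  ∀ i j k l : Fin N, i ≠ j → k ≠ l → (i, j) ≠ (k, l) → rootValue i j D ≠ rootValue k l D

/-- The set `Γ⁺` of the positive roots `α_{ij}`, `i < j`, that occur in `M`. -/
def positiveSupport {N : ℕ} (M : Matrix (Fin N) (Fin N) ℂ) : Set (Fin N × Fin N) :=
  {p | p.1 < p.2 ∧ M p.1 p.2 ≠ 0}

/-- A diagonal matrix `D` is `M`-regular when the values at `D` of the positive roots occurring
in `M` are nonzero and pairwise distinct. -/
def IsRegularAlong {N : ℕ} (D M : Matrix (Fin N) (Fin N) ℂ) : Prop :=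
  (∀ p ∈ positiveSupport M, rootValue p.1 p.2 D ≠ 0) ∧
    ∀ p ∈ positiveSupport M, ∀ q ∈ positiveSupport M, p ≠ q →
      rootValue p.1 p.2 D ≠ rootValue q.1 q.2 D

/-- `X` is, on `[0, T]`, the integral curve in `SU(N)` with `X(0) = 1` of
`X' = (A + u(t) B) X` for the input `u`, which is piecewise constant on `[0, T]`: away from a
finite set `F` of times, `u` is locally constant and the equation holds (entry by entry). -/
def IsTrajectory {N : ℕ} (A B : Matrix (Fin N) (Fin N) ℂ) (T : ℝ) (u : ℝ → ℝ)
    (X : ℝ → Matrix.specialUnitaryGroup (Fin N) ℂ) : Prop :=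
  X 0 = 1 ∧ ContinuousOn X (Set.Icc 0 T) ∧
    ∃ F : Finset ℝ, ∀ s ∈ Set.Ioo 0 T, s ∉ F →
      (∀ᶠ r in 𝓝 s, u r = u s) ∧
      ∀ i j : Fin N,
        HasDerivAt (fun r => (X r : Matrix (Fin N) (Fin N) ℂ) i j)
          (((A + u s • B) * (X s : Matrix (Fin N) (Fin N) ℂ)) i j) s

/-- The set of points of `SU(N)` reachable from the identity at some time `T ≥ 0`. -/
def reachableSet {N : ℕ} (A B : Matrix (Fin N) (Fin N) ℂ) :
    Set (Matrix.specialUnitaryGroup (Fin N) ℂ) :=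
  {Y | ∃ T : ℝ, 0 ≤ T ∧ ∃ (u : ℝ → ℝ) (X : ℝ → Matrix.specialUnitaryGroup (Fin N) ℂ),
    IsTrajectory A B T u X ∧ X T = Y}

/-- Global controllability: the reachable set is all of `SU(N)`. -/
def IsControllable {N : ℕ} (A B : Matrix (Fin N) (Fin N) ℂ) : Prop :=
  reachableSet A B = Set.univ

/-!
The reachable set is a submonoid `S` of `SU(N)`: it contains `exp (t (A + v B))` for `t ≥ 0` and is
closed under products because the system is right invariant.

Lie algebra rank condition. Multiplying a smooth family in `S` through `g` by `exp (t M)` enlarges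
its tangent space by one direction unless that direction is already present. A tangent space `W` of
maximal dimension, at `g`, therefore contains `g u M u⁻¹` for all `u ∈ S` and all `M = A + v B`. The
span of the `u M u⁻¹` is invariant under `ad M`, so `g⁻¹ W` contains the real Lie algebra generated
by `A` and `B`. If this is `su(N)`, then `S` is a neighbourhood of `g` in `SU(N)`. By compactness,
`g⁻¹` is a limit of elements of `S`, so `S` is a neighbourhood of `1`; since each element of `SU(N)`
has roots arbitrarily close to `1`, `S` is all of `SU(N)`.

Generation. Inside the complexification of the Lie algebra generated by `A` and `B`, polynomials in
`ad A` extract `B₀` from `B`, as the `𝓔ᵢ` are distinct. The root vector `e_ij` is a joint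
eigenvector of `ad A` and `ad B₀`, and either regularity condition separates the joint eigenvalues
of those `e_ij` that occur in `B`. Hence they lie in the algebra one by one, and brackets along the
paths of the connected graph produce all the others.
-/

section LieGeneration

open Matrix LieAlgebra.SpecialLinear

attribute [local instance] LieRing.ofAssociativeRing

variable {n : Type*} [Fintype n] [DecidableEq n]

theorem lie_diagonal_apply {R : Type*} [CommRing R] (d : n → R) (X : Matrix n n R) (i j : n) :
    ⁅diagonal d, X⁆ i j = (d i - d j) * X i j := by
  simp only [Ring.lie_def, Matrix.sub_apply, diagonal_mul, mul_diagonal]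
  ring

theorem single_mem_of_reachable {R : Type*} [CommRing R] {L : LieSubalgebra R (Matrix n n R)}
    {G : SimpleGraph n} (hL : ∀ i j, G.Adj i j → single i j (1 : R) ∈ L) {i j : n}
    (hij : G.Reachable i j) (hne : i ≠ j) : single i j (1 : R) ∈ L := by
  rw [SimpleGraph.reachable_iff_reflTransGen] at hij
  induction hij with
  | refl => exact absurd rfl hne
  | @tail j k _ hjk ih =>
    rcases eq_or_ne i j with rfl | hne'
    · exact hL i k hjk
    · have h := L.lie_mem (ih hne') (hL j k hjk)
      rwa [Ring.lie_def, single_mul_single_same, single_mul_single_of_ne _ _ _ _ hne.symm,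
        sub_zero, one_mul] at h

theorem sl_le_of_forall_single_mem {R : Type*} [CommRing R] {L : LieSubalgebra R (Matrix n n R)}
    (hL : ∀ i j, i ≠ j → single i j (1 : R) ∈ L) : sl n R ≤ L := by
  intro X hX
  have htrace : X.trace = 0 := hX
  rcases isEmpty_or_nonempty n with _ | ⟨⟨o⟩⟩
  · rw [Subsingleton.elim X 0]
    exact L.zero_mem
  have hdiag (i : n) : single i i (1 : R) - single o o 1 ∈ L := by
    rcases eq_or_ne i o with rfl | hne
    · simp
    · have h := L.lie_mem (hL i o hne) (hL o i hne.symm)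
      rwa [Ring.lie_def, single_mul_single_same, single_mul_single_same, one_mul] at h
  have hsum : X = ∑ i, ∑ j, X i j • (single i j (1 : R) - if i = j then single o o 1 else 0) := by
    have hcorr : ∑ i, ∑ j, X i j • (if i = j then single o o (1 : R) else 0) = 0 := by
      simp_rw [smul_ite, smul_zero, Finset.sum_ite_eq, Finset.mem_univ, if_true]
      rw [← Finset.sum_smul, show ∑ i, X i i = 0 from htrace, zero_smul]
    simp_rw [smul_sub, Finset.sum_sub_distrib, hcorr, sub_zero, smul_single, smul_eq_mul, mul_one]
    exact matrix_eq_sum_single X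
  rw [hsum]
  refine sum_mem fun i _ => sum_mem fun j _ => L.smul_mem _ ?_
  rcases eq_or_ne i j with rfl | hne
  · simpa using hdiag i
  · simpa [hne] using hL i j hne

theorem eval_gap_mul_mem {R : Type*} [CommRing R] {W : Submodule R (Matrix n n R)} {d : n → R}
    (hW : ∀ X ∈ W, ⁅diagonal d, X⁆ ∈ W) (p : Polynomial R) {X : Matrix n n R} (hX : X ∈ W) :
    of (fun i j => p.eval (d i - d j) * X i j) ∈ W := by
  induction p using Polynomial.induction_on with
  | C a =>
    simp only [Polynomial.eval_C]
    exact W.smul_mem a hX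
  | add p q hp hq =>
    simp only [Polynomial.eval_add, add_mul]
    exact W.add_mem hp hq
  | monomial m a h =>
    convert hW _ h using 1
    ext i j
    simp only [lie_diagonal_apply, of_apply, Polynomial.eval_mul, Polynomial.eval_C,
      Polynomial.eval_pow, Polynomial.eval_X]
    ring

theorem apply_gap_mul_mem {K : Type*} [Field K] {W : Submodule K (Matrix n n K)}
    {d : n → K} (hW : ∀ X ∈ W, ⁅diagonal d, X⁆ ∈ W) (f : K → K) {X : Matrix n n K} (hX : X ∈ W) :
    of (fun i j => f (d i - d j) * X i j) ∈ W := by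
  classical
  let gaps : Finset K := Finset.univ.image fun p : n × n => d p.1 - d p.2
  have heval (i j : n) : (Lagrange.interpolate gaps id f).eval (d i - d j) = f (d i - d j) :=
    Lagrange.eval_interpolate_at_node (v := id) f Function.injective_id.injOn
      (Finset.mem_image_of_mem (fun p : n × n => d p.1 - d p.2) (Finset.mem_univ (i, j)))
  simpa only [heval] using eval_gap_mul_mem hW (Lagrange.interpolate gaps id f) hX

/-- The pairs of gaps `(a i - a j, B i i - B j j)` are distinct for distinct off-diagonal entries
`(i, j)` in the support of `B`: the form in which regularity of the diagonal part of `B` is used. -/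
def SeparatesTransitions {n K : Type*} [Field K] (a : n → K) (B : Matrix n n K) : Prop :=
  ∀ i j k l, i ≠ j → k ≠ l → B i j ≠ 0 → B k l ≠ 0 → a i - a j = a k - a l →
    B i i - B j j = B k k - B l l → i = k ∧ j = l

theorem SeparatesTransitions.single_mem {K : Type*} [Field K] {L : LieSubalgebra K (Matrix n n K)}
    {a : n → K} {B : Matrix n n K} (hsep : SeparatesTransitions a B) (ha : Function.Injective a)
    (haL : diagonal a ∈ L) (hBL : B ∈ L) {i j : n} (hij : i ≠ j) (hB : B i j ≠ 0) :
    single i j (1 : K) ∈ L := by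
  classical
  have hinvariant {d : n → K} (hd : diagonal d ∈ L) (X : Matrix n n K) (hX : X ∈ L.toSubmodule) :
      ⁅diagonal d, X⁆ ∈ L.toSubmodule := L.lie_mem hd hX
  have hdiag : diagonal B.diag ∈ L.toSubmodule := by
    convert apply_gap_mul_mem (hinvariant haL) (Pi.single 0 1) hBL using 1
    ext k l
    rcases eq_or_ne k l with rfl | hkl
    · simp
    · simp [hkl, sub_eq_zero, ha.ne hkl]
  have hcomponent := L.smul_mem (B i j)⁻¹ <|
    apply_gap_mul_mem (hinvariant hdiag) (Pi.single (B i i - B j j) 1) <|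
      apply_gap_mul_mem (hinvariant haL) (Pi.single (a i - a j) 1) hBL
  convert hcomponent using 1
  ext k l
  by_cases hkl : i = k ∧ j = l
  · obtain ⟨rfl, rfl⟩ := hkl
    simp [hB]
  rw [single_apply_of_ne _ _ _ _ _ hkl]
  by_cases hB' : B k l = 0
  · simp [hB']
  by_cases ha' : a k - a l = a i - a j
  · have hkl' : k ≠ l := by
      rintro rfl
      exact hij (ha (sub_eq_zero.1 (ha'.symm.trans (sub_self _))))
    have hB0 : B k k - B l l ≠ B i i - B j j := fun h =>
      hkl (hsep i j k l hij hkl' hB hB' ha'.symm h.symm)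
    simp [hB0]
  · simp [ha']

theorem SeparatesTransitions.sl_le {K : Type*} [Field K] {L : LieSubalgebra K (Matrix n n K)}
    {a : n → K} {B : Matrix n n K} (hsep : SeparatesTransitions a B) (ha : Function.Injective a)
    {G : SimpleGraph n} (hG : G.Preconnected) (hB : ∀ i j, G.Adj i j → B i j ≠ 0)
    (haL : diagonal a ∈ L) (hBL : B ∈ L) : sl n K ≤ L :=
  sl_le_of_forall_single_mem fun i j =>
    single_mem_of_reachable
      (fun k l h => hsep.single_mem ha haL hBL h.ne (hB k l h)) (hG i j)

/-- The complex subalgebra `L + i L` generated by a real subalgebra `L` of a complex Lie algebra. -/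
def complexSpan {𝔤 : Type*} [LieRing 𝔤] [LieAlgebra ℝ 𝔤] [LieAlgebra ℂ 𝔤] [IsScalarTower ℝ ℂ 𝔤]
    (L : LieSubalgebra ℝ 𝔤) : LieSubalgebra ℂ 𝔤 where
  carrier := {X | ∃ P ∈ L, ∃ Q ∈ L, X = P + Complex.I • Q}
  add_mem' := by
    rintro _ _ ⟨P, hP, Q, hQ, rfl⟩ ⟨P', hP', Q', hQ', rfl⟩
    exact ⟨P + P', L.add_mem hP hP', Q + Q', L.add_mem hQ hQ', by module⟩
  zero_mem' := ⟨0, L.zero_mem, 0, L.zero_mem, by simp⟩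
  smul_mem' := by
    rintro c _ ⟨P, hP, Q, hQ, rfl⟩
    refine ⟨c.re • P - c.im • Q, L.sub_mem (L.smul_mem _ hP) (L.smul_mem _ hQ),
      c.re • Q + c.im • P, L.add_mem (L.smul_mem _ hQ) (L.smul_mem _ hP), ?_⟩
    have hc : c = c.re + c.im * Complex.I := (Complex.re_add_im c).symm
    have hI : Complex.I * Complex.I = -1 := Complex.I_mul_I
    simp only [RCLike.real_smul_eq_coe_smul (K := ℂ)]
    match_scalars
    · linear_combination hc
    · linear_combination Complex.I * hc + c.im * hI
  lie_mem' := by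
    rintro _ _ ⟨P, hP, Q, hQ, rfl⟩ ⟨P', hP', Q', hQ', rfl⟩
    refine ⟨⁅P, P'⁆ - ⁅Q, Q'⁆, L.sub_mem (L.lie_mem hP hP') (L.lie_mem hQ hQ'),
      ⁅P, Q'⁆ + ⁅Q, P'⁆, L.add_mem (L.lie_mem hP hQ') (L.lie_mem hQ hP'), ?_⟩
    have hI : Complex.I • Complex.I • ⁅Q, Q'⁆ = -⁅Q, Q'⁆ := by
      rw [smul_smul, Complex.I_mul_I, neg_one_smul]
    simp only [add_lie, lie_add, smul_lie, lie_smul, hI, smul_add]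
    abel

theorem mem_complexSpan_of_mem {𝔤 : Type*} [LieRing 𝔤] [LieAlgebra ℝ 𝔤] [LieAlgebra ℂ 𝔤]
    [IsScalarTower ℝ ℂ 𝔤] {L : LieSubalgebra ℝ 𝔤} {X : 𝔤} (hX : X ∈ L) : X ∈ complexSpan L :=
  ⟨X, hX, 0, L.zero_mem, by simp⟩

/-- The set `su N` as a real Lie algebra, for an arbitrary index type. -/
def suAlgebra (n : Type*) [Fintype n] [DecidableEq n] : LieSubalgebra ℝ (Matrix n n ℂ) where
  carrier := {M | Mᴴ = -M ∧ M.trace = 0}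
  add_mem' := by
    rintro X Y ⟨hX, hX'⟩ ⟨hY, hY'⟩
    exact ⟨by rw [conjTranspose_add, hX, hY, neg_add], by rw [trace_add, hX', hY', add_zero]⟩
  zero_mem' := ⟨by simp, by simp⟩
  smul_mem' := by
    rintro c X ⟨hX, hX'⟩
    exact ⟨by rw [conjTranspose_smul, hX, star_trivial, smul_neg],
      by rw [trace_smul, hX', smul_zero]⟩
  lie_mem' := by
    rintro X Y ⟨hX, -⟩ ⟨hY, -⟩
    refine ⟨?_, by rw [Ring.lie_def, trace_sub, trace_mul_comm, sub_self]⟩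
    rw [Ring.lie_def, conjTranspose_sub, conjTranspose_mul, conjTranspose_mul, hX, hY]
    noncomm_ring

theorem apply_ne_zero_symm {M : Matrix n n ℂ} (hM : M ∈ suAlgebra n) {i j : n} (hij : M i j ≠ 0) :
    M j i ≠ 0 := by
  have h : star (M i j) = -M j i := congrFun (congrFun hM.1 j) i
  exact fun hji => hij (star_eq_zero.1 (by rw [h, hji, neg_zero]))

theorem suAlgebra_le_of_sl_le_complexSpan {L : LieSubalgebra ℝ (Matrix n n ℂ)}
    (hL : L ≤ suAlgebra n) (hsl : sl n ℂ ≤ complexSpan L) : suAlgebra n ≤ L := by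
  intro X hX
  obtain ⟨P, hP, Q, hQ, rfl⟩ := hsl (show X ∈ sl n ℂ from hX.2)
  have hskew := hX.1
  rw [conjTranspose_add, conjTranspose_smul, (hL hP).1, (hL hQ).1, Complex.star_def,
    Complex.conj_I] at hskew
  have hIQ : (2 * Complex.I) • Q = 0 := by linear_combination (norm := module) hskew
  have hQ0 : Q = 0 := (smul_eq_zero.1 hIQ).resolve_left (by simp)
  simpa [hQ0] using hP

section Drift

variable {N : ℕ} {E : Fin N → ℝ} {B : Matrix (Fin N) (Fin N) ℂ}

theorem drift_eq_diagonal (E : Fin N → ℝ) :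
    drift E = diagonal fun k => -Complex.I * (E k : ℂ) :=
  (diagonal_smul _ _).symm

theorem drift_mem_suAlgebra (hE : ∑ k, E k = 0) : drift E ∈ suAlgebra (Fin N) := by
  constructor
  · rw [drift_eq_diagonal, diagonal_conjTranspose, diagonal_neg]
    congr 1
    ext i
    simp
  · rw [drift_eq_diagonal, trace_diagonal, ← Finset.mul_sum, ← Complex.ofReal_sum, hE,
      Complex.ofReal_zero, mul_zero]

theorem suAlgebra_le_lieSpan_pair (hE_trace : ∑ k, E k = 0) (hE : Function.Injective E)
    (hB : B ∈ su N) (hconn : (matrixGraph B).Connected)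
    (hsep : SeparatesTransitions (fun k => (E k : ℂ)) B) :
    suAlgebra (Fin N) ≤ LieSubalgebra.lieSpan ℝ _ {drift E, B} := by
  have hdrift : drift E ∈ LieSubalgebra.lieSpan ℝ _ {drift E, B} :=
    LieSubalgebra.subset_lieSpan (by simp)
  have hB' : B ∈ LieSubalgebra.lieSpan ℝ _ {drift E, B} := LieSubalgebra.subset_lieSpan (by simp)
  refine suAlgebra_le_of_sl_le_complexSpan ?_ ?_
  · rw [LieSubalgebra.lieSpan_le, Set.pair_subset_iff]
    exact ⟨drift_mem_suAlgebra hE_trace, hB⟩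
  refine hsep.sl_le (Complex.ofReal_injective.comp hE) hconn.preconnected ?_ ?_
    (mem_complexSpan_of_mem hB')
  · intro i j hij
    rcases (SimpleGraph.fromRel_adj _ i j).1 hij with ⟨-, h | h⟩
    · exact h
    · exact apply_ne_zero_symm hB h
  · have hdiag : diagonal (fun k => (E k : ℂ)) = Complex.I • drift E := by
      rw [drift, smul_smul, mul_neg, Complex.I_mul_I, neg_neg, one_smul]
    rw [hdiag]
    exact (complexSpan _).smul_mem _ (mem_complexSpan_of_mem hdrift)

theorem IsRegularDiag.separatesTransitions (hreg : IsRegularDiag (diagPart B)) (a : Fin N → ℂ) :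
    SeparatesTransitions a B := by
  intro i j k l hij hkl _ _ _ hgap
  by_contra hne
  exact hreg i j k l hij hkl (mt Prod.mk.inj hne) (by simpa [rootValue, diagPart] using hgap)

theorem IsRegularAlong.separatesTransitions (hE : StrictMono E) (hB : B ∈ su N)
    (hreg : IsRegularAlong (diagPart B) ⁅drift E, B⁆) :
    SeparatesTransitions (fun k => (E k : ℂ)) B := by
  have hsupport {i j : Fin N} (hij : i < j) (h : B i j ≠ 0) :
      (i, j) ∈ positiveSupport ⁅drift E, B⁆ := by
    refine ⟨hij, ?_⟩
    rw [drift_eq_diagonal, lie_diagonal_apply, ← mul_sub]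
    simpa [h, sub_eq_zero] using (hE hij).ne
  have hpos {i j k l : Fin N} (hij : i < j) (hkl : k < l) (hBij : B i j ≠ 0) (hBkl : B k l ≠ 0)
      (hgap : B i i - B j j = B k k - B l l) : i = k ∧ j = l := by
    by_contra hne
    exact hreg.2 _ (hsupport hij hBij) _ (hsupport hkl hBkl) (mt Prod.mk.inj hne)
      (by simpa [rootValue, diagPart] using hgap)
  have hlt {i j : Fin N} : E i - E j < 0 ↔ i < j := sub_neg.trans hE.lt_iff_lt
  intro i j k l hij _ hBij hBkl hEgap hBgap
  have hEgap' : E i - E j = E k - E l := by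
    beta_reduce at hEgap
    exact_mod_cast hEgap
  rcases hij.lt_or_gt with hlt_ij | hlt_ji
  · exact hpos hlt_ij (hlt.1 (hEgap' ▸ hlt.2 hlt_ij)) hBij hBkl hBgap
  · have hlt_lk : l < k := hlt.1 (by linarith [hlt.2 hlt_ji])
    exact (hpos hlt_ji hlt_lk (apply_ne_zero_symm hB hBij) (apply_ne_zero_symm hB hBkl)
      (by linear_combination -hBgap)).symm

end Drift

end LieGeneration

section TangentImages

open NormedSpace

attribute [local instance] LieRing.ofAssociativeRing

section NormedSpace

variable {M : Type*} [NormedAddCommGroup M] [NormedSpace ℝ M]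

/-- `W` is the image of the derivative at `0` of a family `F` of elements of `T` with `F 0 = g`,
strictly differentiable at `0` and parametrised by a Banach space. The parameter spaces used are
products of copies of `ℝ`, so that `V : Type` is no restriction. -/
def IsTangentImage (T : Set M) (g : M) (W : Submodule ℝ M) : Prop :=
  ∃ (V : Type) (_ : NormedAddCommGroup V) (_ : NormedSpace ℝ V) (_ : CompleteSpace V)
    (F : V → M) (F' : V →L[ℝ] M), HasStrictFDerivAt F F' 0 ∧ F 0 = g ∧ (∀ᶠ v in 𝓝 0, F v ∈ T) ∧
      F'.range = W

theorem isTangentImage_bot {T : Set M} {g : M} (hg : g ∈ T) : IsTangentImage T g ⊥ :=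
  ⟨ℝ, inferInstance, inferInstance, inferInstance, fun _ => g, 0, hasStrictFDerivAt_const _ _, rfl,
    .of_forall fun _ => hg, LinearMap.range_zero⟩

namespace IsTangentImage

theorem mem {T : Set M} {g : M} {W : Submodule ℝ M} (h : IsTangentImage T g W) : g ∈ T := by
  obtain ⟨V, _, _, _, F, F', -, rfl, hFT, -⟩ := h
  exact hFT.self_of_nhds

theorem map {M' : Type*} [NormedAddCommGroup M'] [NormedSpace ℝ M'] {T : Set M} {T' : Set M'}
    {g : M} {W : Submodule ℝ M} (hW : IsTangentImage T g W) {f : M → M'} {f' : M →L[ℝ] M'}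
    (hf : HasStrictFDerivAt f f' g) (hT : ∀ᶠ x in 𝓝 g, x ∈ T → f x ∈ T') :
    IsTangentImage T' (f g) (W.map f'.toLinearMap) := by
  obtain ⟨V, _, _, _, F, F', hF, rfl, hFT, rfl⟩ := hW
  refine ⟨V, inferInstance, inferInstance, inferInstance, f ∘ F, f' ∘L F', hf.comp 0 hF, rfl, ?_,
    LinearMap.range_comp _ _⟩
  filter_upwards [hFT, hF.continuousAt.eventually hT] with v hv hv'
  exact hv' hv

theorem mem_nhdsWithin [FiniteDimensional ℝ M] {T : Set M} {g : M} {W L : Submodule ℝ M}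
    (hW : IsTangentImage T g W) (hTL : T ⊆ L) (hLW : L ≤ W) : T ∈ 𝓝[L] g := by
  obtain ⟨V, _, _, _, F, F', hF, rfl, hFT, rfl⟩ := hW
  have hg : F 0 ∈ L := hTL hFT.self_of_nhds
  obtain ⟨P, hP⟩ := Submodule.ClosedComplemented.of_finiteDimensional L
  have hPF : HasStrictFDerivAt (P ∘ F) (P ∘L F') 0 := P.hasStrictFDerivAt.comp 0 hF
  have hsurj : (P ∘L F').range = ⊤ := by
    refine LinearMap.range_eq_top.2 fun Z => ?_
    obtain ⟨v, hv⟩ := hLW Z.2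
    exact ⟨v, (congrArg P hv).trans (hP Z)⟩
  have hmap : Filter.map (P ∘ F) (𝓝 0) = 𝓝 ⟨F 0, hg⟩ := by
    rw [hPF.map_nhds_eq_of_surj hsurj, Function.comp_apply, hP ⟨F 0, hg⟩]
  rw [nhdsWithin_eq_map_subtype_coe hg, Filter.mem_map, ← hmap, Filter.mem_map]
  filter_upwards [hFT] with v hv
  have hPFv : (P (F v) : M) = F v := congrArg Subtype.val (hP ⟨F v, hTL hv⟩)
  rwa [Set.mem_preimage, Set.mem_preimage, Function.comp_apply, hPFv]

end IsTangentImage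

theorem exists_isTangentImage_finrank_max [FiniteDimensional ℝ M] {T : Set M} (hT : T.Nonempty) :
    ∃ g W, IsTangentImage T g W ∧
      ∀ g' W', IsTangentImage T g' W' → Module.finrank ℝ W' ≤ Module.finrank ℝ W := by
  obtain ⟨g₀, hg₀⟩ := hT
  have hbdd : BddAbove {r | ∃ g W, IsTangentImage T g W ∧ Module.finrank ℝ W = r} := by
    refine ⟨Module.finrank ℝ M, ?_⟩
    rintro _ ⟨_, W, -, rfl⟩
    exact W.finrank_le
  have hne : {r | ∃ g W, IsTangentImage T g W ∧ Module.finrank ℝ W = r}.Nonempty :=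
    ⟨_, g₀, ⊥, isTangentImage_bot hg₀, rfl⟩
  obtain ⟨g, W, hW, hr⟩ := Nat.sSup_mem hne hbdd
  exact ⟨g, W, hW, fun g' W' hW' => hr ▸ le_csSup hbdd ⟨g', W', hW', rfl⟩⟩

end NormedSpace

variable {𝔸 : Type*} [NormedRing 𝔸] [NormedAlgebra ℝ 𝔸]

theorem IsTangentImage.mul_right {S : Submonoid 𝔸} {g h : 𝔸} {W : Submodule ℝ 𝔸}
    (hW : IsTangentImage (S : Set 𝔸) g W) (hh : h ∈ S) :
    IsTangentImage (S : Set 𝔸) (g * h) (W.map (LinearMap.mulRight ℝ h)) :=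
  hW.map ((ContinuousLinearMap.mul ℝ 𝔸).flip h).hasStrictFDerivAt
    (.of_forall fun _ hx => S.mul_mem hx hh)

theorem IsTangentImage.mul_exp [CompleteSpace 𝔸] {S : Submonoid 𝔸} {g M : 𝔸} {W : Submodule ℝ 𝔸}
    (hW : IsTangentImage (S : Set 𝔸) g W) (hM : ∀ t : ℝ, 0 ≤ t → exp (t • M) ∈ S) :
    IsTangentImage (S : Set 𝔸) (g * exp M)
      (W.map (LinearMap.mulRight ℝ (exp M)) ⊔ ℝ ∙ (g * M * exp M)) := by
  obtain ⟨V, _, _, _, F, F', hF, rfl, hFS, rfl⟩ := hW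
  -- The new parameter perturbs the time `1`, so that its negative values are admissible too.
  have hexp : HasStrictFDerivAt (fun p : V × ℝ => exp ((p.2 + 1) • M)) _ (0 : V × ℝ) :=
    HasStrictFDerivAt.comp (g := fun t : ℝ => exp (t • M)) (0 : V × ℝ)
      (hasStrictFDerivAt_exp_smul_const' ℝ M _) (hasStrictFDerivAt_snd.add_const 1)
  refine ⟨V × ℝ, inferInstance, inferInstance, inferInstance, _, _,
    (hF.comp (0 : V × ℝ) hasStrictFDerivAt_fst).mul' hexp, by simp, ?_, ?_⟩
  · have hF_mem : ∀ᶠ p in 𝓝 (0 : V × ℝ), F p.1 ∈ S :=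
      (continuous_fst.tendsto (0 : V × ℝ)).eventually hFS
    have htime : ∀ᶠ p in 𝓝 (0 : V × ℝ), (-1 : ℝ) < p.2 :=
      (continuous_snd.tendsto (0 : V × ℝ)).eventually (lt_mem_nhds (by simp))
    filter_upwards [hF_mem, htime] with p hp hp'
    exact S.mul_mem hp (hM _ (by linarith))
  · rw [← LinearMap.range_comp, LinearMap.span_singleton_eq_range, ← LinearMap.range_coprod]
    congr 1
    ext p <;> simp [mul_assoc]

theorem IsTangentImage.mul_conj_mem_of_finrank_max [FiniteDimensional ℝ 𝔸] {S : Submonoid 𝔸}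
    {g M : 𝔸} {W : Submodule ℝ 𝔸} (hW : IsTangentImage (S : Set 𝔸) g W)
    (hmax : ∀ g' W', IsTangentImage (S : Set 𝔸) g' W' → Module.finrank ℝ W' ≤ Module.finrank ℝ W)
    {u : 𝔸ˣ} (hu : (u : 𝔸) ∈ S) (hM : ∀ t : ℝ, 0 ≤ t → exp (t • M) ∈ S) :
    g * (u * M * ↑u⁻¹) ∈ W := by
  have := FiniteDimensional.complete ℝ 𝔸
  let +nondep : NormedAlgebra ℚ 𝔸 := .restrictScalars ℚ ℝ 𝔸
  obtain ⟨v, hv⟩ : IsUnit (u * exp M) := u.isUnit.mul (isUnit_exp M)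
  have hmap : (W.map (LinearMap.mulRight ℝ ↑u)).map (LinearMap.mulRight ℝ (exp M)) =
      W.map (LinearMap.mulRight ℝ ↑v) := by
    rw [← Submodule.map_comp, hv, LinearMap.mulRight_mul]
  have hinj : Function.Injective (LinearMap.mulRight ℝ (v : 𝔸)) := v.isUnit.mul_left_injective
  -- Following `g * u` by `exp M` adds a tangent direction, which maximality makes redundant.
  have hsup := (hW.mul_right hu).mul_exp hM
  have heq : W.map (LinearMap.mulRight ℝ ↑v) = _ :=
    Submodule.eq_of_le_of_finrank_le (hmap.ge.trans le_sup_left)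
      ((hmax _ _ hsup).trans_eq (Submodule.equivMapOfInjective _ hinj W).finrank_eq)
  have hmem : g * ↑u * M * exp M ∈ W.map (LinearMap.mulRight ℝ ↑v) :=
    heq ▸ Submodule.mem_sup_right (Submodule.mem_span_singleton_self _)
  obtain ⟨Y, hY, hYv⟩ := hmem
  suffices h : g * (u * M * ↑u⁻¹) = Y from h ▸ hY
  apply hinj
  rw [hYv]
  simp only [LinearMap.mulRight_apply, hv, mul_assoc, Units.inv_mul_cancel_left]

/-- The real span of the conjugates of elements of `𝓜` by the invertible elements of `S`. -/
noncomputable def conjSpan (S : Submonoid 𝔸) (𝓜 : Set 𝔸) : Submodule ℝ 𝔸 :=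
  Submodule.span ℝ {X | ∃ u : 𝔸ˣ, (u : 𝔸) ∈ S ∧ ∃ M ∈ 𝓜, X = u * M * ↑u⁻¹}

theorem subset_conjSpan (S : Submonoid 𝔸) (𝓜 : Set 𝔸) : 𝓜 ⊆ conjSpan S 𝓜 := fun M hM =>
  Submodule.subset_span ⟨1, S.one_mem, M, hM, by simp⟩

theorem conj_mem_conjSpan {S : Submonoid 𝔸} {𝓜 : Set 𝔸} {u : 𝔸ˣ} (hu : (u : 𝔸) ∈ S) {X : 𝔸}
    (hX : X ∈ conjSpan S 𝓜) : u * X * ↑u⁻¹ ∈ conjSpan S 𝓜 := by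
  induction hX using Submodule.span_induction with
  | mem X hX =>
    obtain ⟨v, hv, M, hM, rfl⟩ := hX
    exact Submodule.subset_span ⟨u * v, S.mul_mem hu hv, M, hM, by simp [mul_assoc]⟩
  | zero => simp
  | add X Y _ _ hX hY =>
    rw [mul_add, add_mul]
    exact add_mem hX hY
  | smul c X _ hX =>
    rw [mul_smul_comm, smul_mul_assoc]
    exact Submodule.smul_mem _ c hX

theorem lie_mem_conjSpan [FiniteDimensional ℝ 𝔸] {S : Submonoid 𝔸} {𝓜 : Set 𝔸} {M X : 𝔸}
    (hM : ∀ t : ℝ, 0 ≤ t → exp (t • M) ∈ S) (hX : X ∈ conjSpan S 𝓜) : ⁅M, X⁆ ∈ conjSpan S 𝓜 := by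
  have := FiniteDimensional.complete ℝ 𝔸
  let +nondep : NormedAlgebra ℚ 𝔸 := .restrictScalars ℚ ℝ 𝔸
  have hderiv : HasDerivAt (fun t : ℝ => exp (t • M) * X * exp (t • -M)) ⁅M, X⁆ 0 := by
    refine (((hasDerivAt_exp_smul_const M (0 : ℝ)).mul_const X).mul
      (hasDerivAt_exp_smul_const (-M) (0 : ℝ))).congr_deriv ?_
    simp [Ring.lie_def, sub_eq_add_neg]
  have hmem (t : ℝ) (ht : 0 ≤ t) : exp (t • M) * X * exp (t • -M) ∈ conjSpan S 𝓜 := by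
    obtain ⟨u, hu⟩ := isUnit_exp (t • M)
    have huinv : (↑u⁻¹ : 𝔸) = exp (t • -M) := by
      rw [smul_neg, ← Ring.inverse_exp, ← hu, Ring.inverse_unit]
    rw [← hu, ← huinv]
    exact conj_mem_conjSpan (hu ▸ hM t ht) hX
  refine (Submodule.closed_of_finiteDimensional _).mem_of_tendsto
    hderiv.tendsto_slope_zero_right ?_
  filter_upwards [self_mem_nhdsWithin] with t ht
  exact Submodule.smul_mem _ _ (sub_mem (hmem _ (by simpa using le_of_lt ht)) (hmem 0 le_rfl))

theorem lieSpan_le_of_ad_invariant {R L : Type*} [CommRing R] [LieRing L] [LieAlgebra R L]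
    {s : Set L} {V : Submodule R L} (hsV : s ⊆ V) (hV : ∀ x ∈ s, ∀ y ∈ V, ⁅x, y⁆ ∈ V) :
    (LieSubalgebra.lieSpan R L s).toSubmodule ≤ V := by
  suffices h : ∀ x ∈ LieSubalgebra.lieSpan R L s, x ∈ V ∧ ∀ y ∈ V, ⁅x, y⁆ ∈ V from
    fun x hx => (h x hx).1
  intro x hx
  induction hx using LieSubalgebra.lieSpan_induction with
  | mem x hx => exact ⟨hsV hx, hV x hx⟩
  | zero => exact ⟨V.zero_mem, fun y _ => by simp⟩
  | add x y _ _ hx hy =>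
    exact ⟨V.add_mem hx.1 hy.1, fun z hz => by
      rw [add_lie]; exact V.add_mem (hx.2 z hz) (hy.2 z hz)⟩
  | smul c x _ hx =>
    exact ⟨V.smul_mem c hx.1, fun z hz => by rw [smul_lie]; exact V.smul_mem c (hx.2 z hz)⟩
  | lie x y _ _ hx hy =>
    exact ⟨hx.2 y hy.1, fun z hz => by
      rw [lie_lie]; exact V.sub_mem (hx.2 _ (hy.2 z hz)) (hy.2 _ (hx.2 z hz))⟩

theorem exists_isTangentImage_mul_lieSpan_le [FiniteDimensional ℝ 𝔸] {S : Submonoid 𝔸} {𝓜 : Set 𝔸}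
    (h𝓜 : ∀ M ∈ 𝓜, ∀ t : ℝ, 0 ≤ t → exp (t • M) ∈ S) :
    ∃ g W, IsTangentImage (S : Set 𝔸) g W ∧ ∀ X ∈ LieSubalgebra.lieSpan ℝ 𝔸 𝓜, g * X ∈ W := by
  obtain ⟨g, W, hW, hmax⟩ := exists_isTangentImage_finrank_max (T := (S : Set 𝔸)) ⟨1, S.one_mem⟩
  refine ⟨g, W, hW, fun X hX => ?_⟩
  have hXconj : X ∈ conjSpan S 𝓜 :=
    lieSpan_le_of_ad_invariant (subset_conjSpan S 𝓜)
      (fun M hM Y hY => lie_mem_conjSpan (h𝓜 M hM) hY) hX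
  have hconj : conjSpan S 𝓜 ≤ W.comap (LinearMap.mulLeft ℝ g) := by
    refine Submodule.span_le.2 ?_
    rintro _ ⟨u, hu, M, hM, rfl⟩
    exact hW.mul_conj_mem_of_finrank_max hmax hu (h𝓜 M hM)
  exact hconj hXconj

end TangentImages

section CompactGroups

theorem submonoid_mem_nhds_one_of_mem_nhds {G : Type*} [Group G] [TopologicalSpace G]
    [IsTopologicalGroup G] [CompactSpace G] {S : Submonoid G} {s : G} (hs : (S : Set G) ∈ 𝓝 s) :
    (S : Set G) ∈ 𝓝 1 := by
  have hclosure : s⁻¹ ∈ closure (S : Set G) := by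
    have h := closure_submonoidClosure_eq_closure_subgroupClosure (S : Set G)
    rw [Submonoid.closure_eq] at h
    rw [h]
    exact subset_closure (inv_mem (Subgroup.subset_closure (mem_of_mem_nhds hs)))
  have hinv : {x : G | (S : Set G) ∈ 𝓝 x⁻¹} ∈ 𝓝 s⁻¹ := by
    have h := continuous_inv.tendsto s⁻¹
    rw [inv_inv] at h
    exact h.eventually (eventually_mem_nhds_iff.2 hs)
  obtain ⟨x, hx, hxS⟩ := mem_closure_iff_nhds.1 hclosure _ hinv
  have htranslate : Filter.Tendsto (fun y : G => y * x⁻¹) (𝓝 1) (𝓝 x⁻¹) := by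
    have h : Continuous fun y : G => y * x⁻¹ := by fun_prop
    simpa only [one_mul] using h.tendsto 1
  filter_upwards [htranslate.eventually_mem hx] with y hy
  simpa using S.mul_mem hy hxS

end CompactGroups

section LocalLogarithm

open NormedSpace

theorem exists_local_log (𝔸 : Type*) [NormedRing 𝔸] [NormedAlgebra ℝ 𝔸] [CompleteSpace 𝔸] :
    ∃ log : 𝔸 → 𝔸, HasStrictFDerivAt log (ContinuousLinearMap.id ℝ 𝔸) 1 ∧ log 1 = 0 ∧
      (∀ᶠ Z in 𝓝 0, log (exp Z) = Z) ∧ ∀ᶠ Y in 𝓝 1, exp (log Y) = Y := by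
  have hexp : HasStrictFDerivAt (exp : 𝔸 → 𝔸)
      (ContinuousLinearEquiv.refl ℝ 𝔸 : 𝔸 →L[ℝ] 𝔸) 0 := hasStrictFDerivAt_exp_zero
  refine ⟨hexp.localInverse _ _ _, ?_, ?_, hexp.eventually_left_inverse, ?_⟩
  · have h := hexp.to_localInverse
    rwa [exp_zero] at h
  · simpa only [exp_zero] using hexp.localInverse_apply_image
  · simpa only [exp_zero] using hexp.eventually_right_inverse

end LocalLogarithm

section SpecialUnitaryGroup

open Matrix NormedSpace
open scoped Matrix.Norms.L2Operator

attribute [local instance] LieRing.ofAssociativeRing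

variable {n : Type*} [Fintype n] [DecidableEq n]

instance : IsTopologicalGroup (specialUnitaryGroup n ℂ) where
  continuous_inv := Continuous.subtype_mk (continuous_star.comp continuous_subtype_val) _

instance : CompactSpace (specialUnitaryGroup n ℂ) := by
  have hclosed : IsClosed (specialUnitaryGroup n ℂ : Set (Matrix n n ℂ)) := by
    have h : (specialUnitaryGroup n ℂ : Set (Matrix n n ℂ)) =
        (fun X : Matrix n n ℂ => (X * star X, X.det)) ⁻¹' {(1, 1)} := by
      ext X
      simp [mem_specialUnitaryGroup_iff, mem_unitaryGroup_iff]
    rw [h]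
    exact isClosed_singleton.preimage (by fun_prop)
  have hbdd : Bornology.IsBounded (specialUnitaryGroup n ℂ : Set (Matrix n n ℂ)) := by
    refine (Metric.isBounded_closedBall (x := (0 : Matrix n n ℂ)) (r := 1)).subset fun X hX => ?_
    rw [mem_closedBall_zero_iff]
    rcases subsingleton_or_nontrivial (Matrix n n ℂ) with _ | _
    · rw [Subsingleton.elim X 0, norm_zero]
      exact zero_le_one
    · exact (CStarRing.norm_of_mem_unitary (mem_specialUnitaryGroup_iff.1 hX).1).le
  have : ProperSpace (Matrix n n ℂ) := FiniteDimensional.proper ℝ _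
  exact isCompact_iff_compactSpace.1 (Metric.isCompact_of_isClosed_isBounded hclosed hbdd)

theorem exp_unitary_conj_diagonal (U : unitaryGroup n ℂ) (d : n → ℂ) :
    exp ((U : Matrix n n ℂ) * diagonal d * star (U : Matrix n n ℂ)) =
      U * diagonal (fun i => Complex.exp (d i)) * star (U : Matrix n n ℂ) := by
  have hexp : exp d = fun i => Complex.exp (d i) := by
    ext i
    rw [Pi.coe_exp, Complex.exp_eq_exp_ℂ]
  rw [← hexp, ← Matrix.exp_diagonal]
  exact Matrix.exp_units_conj (Unitary.toUnits U) (diagonal d)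

theorem det_unitary_conj (U : unitaryGroup n ℂ) (X : Matrix n n ℂ) :
    (U * X * star (U : Matrix n n ℂ)).det = X.det := by
  rw [det_mul_right_comm, Unitary.mul_star_self_of_mem U.2, one_mul]

theorem trace_unitary_conj (U : unitaryGroup n ℂ) (X : Matrix n n ℂ) :
    (U * X * star (U : Matrix n n ℂ)).trace = X.trace := by
  rw [trace_mul_cycle, Unitary.coe_star_mul_self, one_mul]

theorem exists_unitary_conj_diagonal_of_skew {M : Matrix n n ℂ} (hM : Mᴴ = -M) :
    ∃ (U : unitaryGroup n ℂ) (d : n → ℂ), M = U * diagonal d * star (U : Matrix n n ℂ) := by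
  have hIM : ((-Complex.I) • M).IsHermitian := by
    rw [IsHermitian, conjTranspose_smul, hM]
    simp
  have hspectral := hIM.spectral_theorem
  rw [Unitary.conjStarAlgAut_apply] at hspectral
  refine ⟨hIM.eigenvectorUnitary, Complex.I • (RCLike.ofReal ∘ hIM.eigenvalues), ?_⟩
  rw [diagonal_smul, mul_smul_comm, smul_mul_assoc, ← hspectral, smul_smul, mul_neg,
    Complex.I_mul_I, neg_neg, one_smul]

theorem det_exp_of_skew {M : Matrix n n ℂ} (hM : Mᴴ = -M) :
    (exp M).det = Complex.exp M.trace := by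
  obtain ⟨U, d, rfl⟩ := exists_unitary_conj_diagonal_of_skew hM
  rw [exp_unitary_conj_diagonal, det_unitary_conj, det_diagonal, trace_unitary_conj, trace_diagonal,
    Complex.exp_sum]

theorem exp_mem_specialUnitaryGroup {M : Matrix n n ℂ} (hM : M ∈ suAlgebra n) :
    exp M ∈ specialUnitaryGroup n ℂ := by
  let +nondep : NormedAlgebra ℚ (Matrix n n ℂ) := .restrictScalars ℚ ℝ _
  refine mem_specialUnitaryGroup_iff.2
    ⟨exp_mem_unitary_of_mem_skewAdjoint (skewAdjoint.mem_iff.2 hM.1), ?_⟩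
  rw [det_exp_of_skew hM.1, show M.trace = 0 from hM.2, Complex.exp_zero]

theorem exists_skew_exp_eq {X : Matrix n n ℂ} (hX : X ∈ unitaryGroup n ℂ) :
    ∃ M : Matrix n n ℂ, Mᴴ = -M ∧ exp M = X := by
  have hnormal : IsStarNormal X := ⟨by
    rw [Commute, SemiconjBy, Unitary.star_mul_self_of_mem hX, Unitary.mul_star_self_of_mem hX]⟩
  let log : ℂ → ℂ := fun z => Complex.I * (Complex.arg z : ℂ)
  have hlog : ContinuousOn log (spectrum ℂ X) := (Matrix.finite_spectrum X).continuousOn log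
  have hexp : ContinuousOn Complex.exp (log '' spectrum ℂ X) := Complex.continuous_exp.continuousOn
  refine ⟨cfc log X, ?_, ?_⟩
  · rw [← star_eq_conjTranspose, ← cfc_star, ← cfc_neg]
    congr 1
    ext z
    simp [log]
  · rw [← CFC.complex_exp_eq_normedSpace_exp (cfc_predicate log X),
      ← cfc_comp Complex.exp log X hnormal hexp hlog]
    conv_rhs => rw [← cfc_id ℂ X hnormal]
    refine cfc_congr fun z hz => ?_
    have hz_norm : ‖z‖ = 1 := by
      simpa using Unitary.spectrum_subset_circle (⟨X, hX⟩ : unitary (Matrix n n ℂ)) hz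
    have hz_polar := Complex.norm_mul_exp_arg_mul_I z
    rwa [hz_norm, Complex.ofReal_one, one_mul, mul_comm] at hz_polar

/-- Adding integer multiples of `J` to `M` corrects the trace and does not change `exp M`. -/
theorem exists_commute_skew_exp_eq_one [Nonempty n] {M : Matrix n n ℂ} (hM : Mᴴ = -M) :
    ∃ J : Matrix n n ℂ, Commute M J ∧ Jᴴ = -J ∧ exp J = 1 ∧
      J.trace = 2 * Real.pi * Complex.I := by
  obtain ⟨U, d, rfl⟩ := exists_unitary_conj_diagonal_of_skew hM
  let e : n → ℂ := Pi.single (Classical.arbitrary n) (2 * Real.pi * Complex.I)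
  have he_star : star e = -e := by
    rw [← Pi.single_star, ← Pi.single_neg]
    simp
  have he_exp (i : n) : Complex.exp (e i) = 1 := by
    rcases eq_or_ne i (Classical.arbitrary n) with rfl | hi
    · simp [e, Complex.exp_two_pi_mul_I]
    · simp [e, hi]
  refine ⟨U * diagonal e * star (U : Matrix n n ℂ), ?_, ?_, ?_, ?_⟩
  · exact (commute_diagonal d e).map (Unitary.conjStarAlgAut ℂ _ U)
  · rw [← star_eq_conjTranspose, star_mul, star_mul, star_star, star_eq_conjTranspose (diagonal e),
      diagonal_conjTranspose, he_star, show diagonal (-e) = -diagonal e from (diagonal_neg e).symm,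
      neg_mul, mul_neg, mul_assoc]
  · simp only [exp_unitary_conj_diagonal, he_exp, diagonal_one, mul_one,
      Unitary.mul_star_self_of_mem U.2]
  · rw [trace_unitary_conj, trace_diagonal, Finset.sum_pi_single', if_pos (Finset.mem_univ _)]

theorem exists_mem_suAlgebra_exp_eq {X : Matrix n n ℂ} (hX : X ∈ specialUnitaryGroup n ℂ) :
    ∃ M ∈ suAlgebra n, exp M = X := by
  rcases isEmpty_or_nonempty n with _ | _
  · exact ⟨0, (suAlgebra n).zero_mem, Subsingleton.elim _ _⟩
  rw [mem_specialUnitaryGroup_iff] at hX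
  obtain ⟨M, hM, rfl⟩ := exists_skew_exp_eq hX.1
  obtain ⟨k, hk⟩ := Complex.exp_eq_one_iff.1 ((det_exp_of_skew hM).symm.trans hX.2)
  obtain ⟨J, hcomm, hJ, hJ_exp, hJ_trace⟩ := exists_commute_skew_exp_eq_one hM
  refine ⟨M - k • J, ⟨?_, ?_⟩, ?_⟩
  · rw [conjTranspose_sub, conjTranspose_zsmul, hM, hJ]
    module
  · rw [trace_sub, trace_smul, hJ_trace, hk, zsmul_eq_mul, sub_self]
  · rw [sub_eq_add_neg, ← neg_smul, Matrix.exp_add_of_commute _ _ (hcomm.smul_right (-k)),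
      Matrix.exp_zsmul, hJ_exp, Matrix.one_zpow, mul_one]

theorem eq_top_of_mem_nhds_one {S : Submonoid (specialUnitaryGroup n ℂ)}
    (hS : (S : Set (specialUnitaryGroup n ℂ)) ∈ 𝓝 1) : S = ⊤ := by
  refine eq_top_iff.2 fun X _ => ?_
  obtain ⟨M, hM, hMX⟩ := exists_mem_suAlgebra_exp_eq X.2
  let γ : ℝ → specialUnitaryGroup n ℂ := fun t =>
    ⟨exp (t • M), exp_mem_specialUnitaryGroup ((suAlgebra n).smul_mem t hM)⟩
  have hγ : Continuous γ :=
    Continuous.subtype_mk (continuous_iff_continuousAt.2 fun t =>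
      (hasDerivAt_exp_smul_const M t).continuousAt) _
  have hγ_zero : γ 0 = 1 := Subtype.ext (by simp [γ])
  have hroot : Filter.Tendsto (fun m : ℕ => γ (1 / ((m : ℝ) + 1))) Filter.atTop (𝓝 1) :=
    hγ_zero ▸ (hγ.tendsto 0).comp tendsto_one_div_add_atTop_nhds_zero_nat
  obtain ⟨m, hm⟩ := (hroot.eventually_mem hS).exists
  have hpow : γ (1 / ((m : ℝ) + 1)) ^ (m + 1) = X := by
    refine Subtype.ext ?_
    rw [SubmonoidClass.coe_pow, ← hMX]
    change exp _ ^ (m + 1) = exp M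
    have hm0 : (m : ℝ) + 1 ≠ 0 := by positivity
    rw [← Matrix.exp_nsmul, ← Nat.cast_smul_eq_nsmul ℝ, smul_smul, Nat.cast_add, Nat.cast_one,
      mul_one_div_cancel hm0, one_smul]
  exact hpow ▸ S.pow_mem hm _

theorem eventually_mem_suAlgebra_of_exp_mem :
    ∀ᶠ Z in 𝓝 (0 : Matrix n n ℂ), exp Z ∈ specialUnitaryGroup n ℂ → Z ∈ suAlgebra n := by
  obtain ⟨log, -, -, hlog, -⟩ := exists_local_log (Matrix n n ℂ)
  obtain ⟨clog, -, hclog_one, hclog, -⟩ := exists_local_log ℂ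
  have hlog_star : ∀ᶠ Z in 𝓝 (0 : Matrix n n ℂ), log (exp Zᴴ) = Zᴴ :=
    (Continuous.tendsto' (by fun_prop) 0 0 conjTranspose_zero).eventually hlog
  have hlog_neg : ∀ᶠ Z in 𝓝 (0 : Matrix n n ℂ), log (exp (-Z)) = -Z :=
    (Continuous.tendsto' (by fun_prop) 0 0 neg_zero).eventually hlog
  have hlog_trace : ∀ᶠ Z in 𝓝 (0 : Matrix n n ℂ), clog (exp Z.trace) = Z.trace :=
    (Continuous.tendsto' (by fun_prop) 0 0 (trace_zero n ℂ)).eventually hclog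
  filter_upwards [hlog_star, hlog_neg, hlog_trace] with Z hZ_star hZ_neg hZ_trace hZ
  rw [mem_specialUnitaryGroup_iff] at hZ
  have hinv : exp Zᴴ = exp (-Z) := by
    rw [Matrix.exp_conjTranspose, Matrix.exp_neg]
    exact (inv_eq_left_inv (Unitary.star_mul_self_of_mem hZ.1)).symm
  have hskew : Zᴴ = -Z := by rw [← hZ_star, hinv, hZ_neg]
  refine ⟨hskew, ?_⟩
  rw [← hZ_trace, ← Complex.exp_eq_exp_ℂ, ← det_exp_of_skew hskew, hZ.2, hclog_one]

theorem IsTangentImage.mem_nhdsWithin_one {T : Set (Matrix n n ℂ)}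
    {W : Submodule ℝ (Matrix n n ℂ)} (hW : IsTangentImage T 1 W)
    (hT : T ⊆ specialUnitaryGroup n ℂ) (hsu : (suAlgebra n).toSubmodule ≤ W) :
    T ∈ 𝓝[(specialUnitaryGroup n ℂ : Set (Matrix n n ℂ))] 1 := by
  obtain ⟨log, hlog_deriv, hlog_one, -, hexp_log⟩ := exists_local_log (Matrix n n ℂ)
  have hlog_tendsto : Filter.Tendsto log (𝓝 1) (𝓝 0) := hlog_one ▸ hlog_deriv.continuousAt
  have hlog_mem : ∀ᶠ Y in 𝓝 1, Y ∈ specialUnitaryGroup n ℂ → log Y ∈ suAlgebra n := by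
    filter_upwards [hlog_tendsto.eventually eventually_mem_suAlgebra_of_exp_mem, hexp_log]
      with Y hY hY_exp
    rwa [hY_exp] at hY
  let T' : Set (Matrix n n ℂ) := {Z | Z ∈ suAlgebra n ∧ exp Z ∈ T}
  have himage : IsTangentImage T' 0 W := by
    have h := hW.map (T' := T') hlog_deriv <| by
      filter_upwards [hlog_mem, hexp_log] with Y hY hY_exp hYT
      exact ⟨hY (hT hYT), hY_exp.symm ▸ hYT⟩
    rwa [hlog_one, ContinuousLinearMap.coe_id, Submodule.map_id] at h
  have hT' : T' ∈ 𝓝[(suAlgebra n).toSubmodule] 0 :=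
    himage.mem_nhdsWithin (fun _ hZ => hZ.1) hsu
  filter_upwards [nhdsWithin_le_nhds hexp_log, self_mem_nhdsWithin, nhdsWithin_le_nhds hlog_mem,
    nhdsWithin_le_nhds (hlog_tendsto.eventually (mem_nhdsWithin_iff_eventually.1 hT'))]
    with Y hY_exp hY hY_mem hY_log
  exact hY_exp ▸ (hY_log (hY_mem hY)).2

theorem IsTangentImage.mem_nhdsWithin_specialUnitaryGroup {T : Set (Matrix n n ℂ)}
    {g : Matrix n n ℂ} {W : Submodule ℝ (Matrix n n ℂ)} (hW : IsTangentImage T g W)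
    (hT : T ⊆ specialUnitaryGroup n ℂ) (hsu : ∀ X ∈ suAlgebra n, g * X ∈ W) :
    T ∈ 𝓝[(specialUnitaryGroup n ℂ : Set (Matrix n n ℂ))] g := by
  have hg := mem_specialUnitaryGroup_iff.1 (hT hW.mem)
  have hg_star : star g ∈ specialUnitaryGroup n ℂ :=
    (star (⟨g, hT hW.mem⟩ : specialUnitaryGroup n ℂ)).2
  have hgg : star g * g = 1 := Unitary.star_mul_self_of_mem hg.1
  have hgg' : g * star g = 1 := Unitary.mul_star_self_of_mem hg.1
  let T' : Set (Matrix n n ℂ) := {Y | Y ∈ specialUnitaryGroup n ℂ ∧ g * Y ∈ T}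
  have hT' : T' ∈ 𝓝[(specialUnitaryGroup n ℂ : Set (Matrix n n ℂ))] 1 := by
    have himage := hW.map (T' := T') (ContinuousLinearMap.mul ℝ _ (star g)).hasStrictFDerivAt <|
      .of_forall fun x hx => ⟨mul_mem hg_star (hT hx), by
        rwa [ContinuousLinearMap.mul_apply', ← mul_assoc, hgg', one_mul]⟩
    rw [ContinuousLinearMap.mul_apply', hgg] at himage
    refine himage.mem_nhdsWithin_one (fun _ hY => hY.1) fun X hX => ⟨g * X, hsu X hX, ?_⟩
    change star g * (g * X) = X
    rw [← mul_assoc, hgg, one_mul]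
  have htranslate : Filter.Tendsto (fun Y => star g * Y) (𝓝 g) (𝓝 1) :=
    Continuous.tendsto' (by fun_prop) _ _ hgg
  filter_upwards [self_mem_nhdsWithin,
    nhdsWithin_le_nhds (htranslate.eventually (mem_nhdsWithin_iff_eventually.1 hT'))] with Y hY hYT
  have h := (hYT (mul_mem hg_star hY)).2
  rwa [← mul_assoc, hgg', one_mul] at h

theorem eq_top_of_suAlgebra_le_lieSpan {S : Submonoid (specialUnitaryGroup n ℂ)}
    {𝓜 : Set (Matrix n n ℂ)}
    (h𝓜 : ∀ M ∈ 𝓜, ∀ t : ℝ, 0 ≤ t → exp (t • M) ∈ S.map (specialUnitaryGroup n ℂ).subtype)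
    (hsu : suAlgebra n ≤ LieSubalgebra.lieSpan ℝ (Matrix n n ℂ) 𝓜) : S = ⊤ := by
  obtain ⟨g, W, hW, hlieSpan⟩ := exists_isTangentImage_mul_lieSpan_le h𝓜
  obtain ⟨s, -, rfl⟩ := hW.mem
  have hnhds := hW.mem_nhdsWithin_specialUnitaryGroup (by rintro _ ⟨x, -, rfl⟩; exact x.2)
    fun X hX => hlieSpan X (hsu hX)
  have hS : (S : Set (specialUnitaryGroup n ℂ)) ∈ 𝓝 s := by
    filter_upwards [preimage_coe_mem_nhds_subtype.2 hnhds] with x hx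
    obtain ⟨y, hy, hyx⟩ := hx
    rwa [← Subtype.ext hyx]
  exact eq_top_of_mem_nhds_one (submonoid_mem_nhds_one_of_mem_nhds hS)

end SpecialUnitaryGroup

section Control

open Matrix NormedSpace
open scoped Matrix.Norms.L2Operator

attribute [local instance] LieRing.ofAssociativeRing

variable {N : ℕ} {A B : Matrix (Fin N) (Fin N) ℂ}

/-- The condition that `IsTrajectory` imposes on the input `u` and the curve `X` at a time `s`
outside the exceptional set. -/
def IsRegularTime (A B : Matrix (Fin N) (Fin N) ℂ) (u : ℝ → ℝ)
    (X : ℝ → specialUnitaryGroup (Fin N) ℂ) (s : ℝ) : Prop :=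
  (∀ᶠ r in 𝓝 s, u r = u s) ∧
    ∀ i j : Fin N,
      HasDerivAt (fun r => (X r : Matrix (Fin N) (Fin N) ℂ) i j)
        (((A + u s • B) * (X s : Matrix (Fin N) (Fin N) ℂ)) i j) s

namespace IsRegularTime

variable {u v : ℝ → ℝ} {X Y : ℝ → specialUnitaryGroup (Fin N) ℂ} {s : ℝ}

theorem congr (h : IsRegularTime A B u X s) (hv : v =ᶠ[𝓝 s] u) (hY : Y =ᶠ[𝓝 s] X) :
    IsRegularTime A B v Y s := by
  refine ⟨?_, fun i j => ?_⟩
  · filter_upwards [h.1, hv] with r hr hvr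
    rw [hvr, hr, hv.self_of_nhds]
  · rw [hv.self_of_nhds, hY.self_of_nhds]
    exact (h.2 i j).congr_of_eventuallyEq (hY.mono fun r hr => by beta_reduce; rw [hr])

theorem comp_sub_mul (T : ℝ) (h : IsRegularTime A B u X (s - T))
    (Z : specialUnitaryGroup (Fin N) ℂ) :
    IsRegularTime A B (fun r => u (r - T)) (fun r => X (r - T) * Z) s := by
  refine ⟨((continuous_sub_right T).tendsto s).eventually h.1, fun i j => ?_⟩
  simp only [Submonoid.coe_mul, ← mul_assoc]
  rw [Matrix.mul_apply]
  simp only [Matrix.mul_apply (N := (Z : Matrix (Fin N) (Fin N) ℂ))]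
  exact HasDerivAt.fun_sum fun k _ => ((h.2 i k).comp_sub_const s T).mul_const _

end IsRegularTime

theorem isRegularTime_exp_smul (v : ℝ) {γ : ℝ → specialUnitaryGroup (Fin N) ℂ}
    (hγ : ∀ t, (γ t : Matrix (Fin N) (Fin N) ℂ) = exp (t • (A + v • B))) (s : ℝ) :
    IsRegularTime A B (fun _ => v) γ s := by
  refine ⟨.of_forall fun _ => rfl, fun i j => ?_⟩
  simp only [hγ]
  exact (Matrix.entryLinearMap ℝ ℂ i j).toContinuousLinearMap.hasFDerivAt.comp_hasDerivAt s
    (hasDerivAt_exp_smul_const' (A + v • B) s)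

theorem one_mem_reachableSet (A B : Matrix (Fin N) (Fin N) ℂ) : 1 ∈ reachableSet A B :=
  ⟨0, le_rfl, fun _ => 0, fun _ => 1, ⟨rfl, continuousOn_const, ∅, fun s hs _ => by
    simp at hs⟩, rfl⟩

/-- The concatenation of two inputs, the second one starting at time `T`. -/
noncomputable def concatInput (T : ℝ) (u₁ u₂ : ℝ → ℝ) (s : ℝ) : ℝ :=
  if s ≤ T then u₁ s else u₂ (s - T)

/-- The concatenation of two curves in a group, the second one starting at time `T` and translated
so as to start where the first one is at that time. -/
noncomputable def concatCurve {G : Type*} [Mul G] (T : ℝ) (X₁ X₂ : ℝ → G) (s : ℝ) : G :=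
  if s ≤ T then X₁ s else X₂ (s - T) * X₁ T

theorem concatCurve_of_le {G : Type*} [Mul G] {T : ℝ} {X₁ X₂ : ℝ → G} {s : ℝ} (hs : s ≤ T) :
    concatCurve T X₁ X₂ s = X₁ s :=
  if_pos hs

theorem concatCurve_of_ge {G : Type*} [MulOneClass G] {T : ℝ} {X₁ X₂ : ℝ → G} (hX₂ : X₂ 0 = 1)
    {s : ℝ} (hs : T ≤ s) : concatCurve T X₁ X₂ s = X₂ (s - T) * X₁ T := by
  rcases hs.eq_or_lt with rfl | hs
  · rw [concatCurve_of_le le_rfl, sub_self, hX₂, one_mul]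
  · exact if_neg (not_le.2 hs)

theorem continuousOn_concatCurve {G : Type*} [MulOneClass G] [TopologicalSpace G]
    [ContinuousMul G] {T₁ T₂ : ℝ} {X₁ X₂ : ℝ → G} (hT₁ : 0 ≤ T₁) (hT₂ : 0 ≤ T₂)
    (hX₁ : ContinuousOn X₁ (Set.Icc 0 T₁)) (hX₂ : ContinuousOn X₂ (Set.Icc 0 T₂))
    (hX₂_zero : X₂ 0 = 1) : ContinuousOn (concatCurve T₁ X₁ X₂) (Set.Icc 0 (T₁ + T₂)) := by
  rw [← Set.Icc_union_Icc_eq_Icc hT₁ (le_add_of_nonneg_right hT₂)]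
  have hshift : ContinuousOn (fun s => X₂ (s - T₁)) (Set.Icc T₁ (T₁ + T₂)) :=
    hX₂.comp (continuous_sub_right T₁).continuousOn fun s hs =>
      ⟨sub_nonneg.2 hs.1, sub_le_iff_le_add'.2 hs.2⟩
  exact ContinuousOn.union_of_isClosed (hX₁.congr fun s hs => concatCurve_of_le hs.2)
    ((hshift.mul continuousOn_const).congr fun s hs => concatCurve_of_ge hX₂_zero hs.1)
    isClosed_Icc isClosed_Icc

theorem IsTrajectory.concat {T₁ T₂ : ℝ} {u₁ u₂ : ℝ → ℝ}
    {X₁ X₂ : ℝ → specialUnitaryGroup (Fin N) ℂ} (hT₁ : 0 ≤ T₁) (hT₂ : 0 ≤ T₂)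
    (h₁ : IsTrajectory A B T₁ u₁ X₁) (h₂ : IsTrajectory A B T₂ u₂ X₂) :
    IsTrajectory A B (T₁ + T₂) (concatInput T₁ u₁ u₂) (concatCurve T₁ X₁ X₂) := by
  obtain ⟨hX₁_zero, hX₁, F₁, hF₁⟩ := h₁
  obtain ⟨hX₂_zero, hX₂, F₂, hF₂⟩ := h₂
  refine ⟨(concatCurve_of_le hT₁).trans hX₁_zero,
    continuousOn_concatCurve hT₁ hT₂ hX₁ hX₂ hX₂_zero, insert T₁ (F₁ ∪ F₂.image (· + T₁)),
    fun s hs hsF => ?_⟩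
  simp only [Finset.mem_insert, Finset.mem_union, Finset.mem_image, not_or] at hsF
  obtain ⟨hsT₁, hsF₁, hsF₂⟩ := hsF
  rcases lt_or_gt_of_ne hsT₁ with hlt | hgt
  · have hnear : ∀ᶠ r in 𝓝 s, r < T₁ := gt_mem_nhds hlt
    exact IsRegularTime.congr (hF₁ s ⟨hs.1, hlt⟩ hsF₁) (hnear.mono fun r hr => if_pos hr.le)
      (hnear.mono fun r hr => if_pos hr.le)
  · have hnear : ∀ᶠ r in 𝓝 s, T₁ < r := lt_mem_nhds hgt
    have hs₂ : s - T₁ ∉ F₂ := fun h => hsF₂ ⟨s - T₁, h, sub_add_cancel s T₁⟩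
    have h : IsRegularTime A B u₂ X₂ (s - T₁) :=
      hF₂ _ ⟨sub_pos.2 hgt, sub_lt_iff_lt_add'.2 hs.2⟩ hs₂
    exact (h.comp_sub_mul T₁ (X₁ T₁)).congr (hnear.mono fun r hr => if_neg (not_le.2 hr))
      (hnear.mono fun r hr => if_neg (not_le.2 hr))

theorem mul_mem_reachableSet {Y Z : specialUnitaryGroup (Fin N) ℂ} (hY : Y ∈ reachableSet A B)
    (hZ : Z ∈ reachableSet A B) : Y * Z ∈ reachableSet A B := by
  obtain ⟨T₂, hT₂, u₂, X₂, h₂, rfl⟩ := hY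
  obtain ⟨T₁, hT₁, u₁, X₁, h₁, rfl⟩ := hZ
  refine ⟨T₁ + T₂, add_nonneg hT₁ hT₂, _, _, h₁.concat hT₁ hT₂ h₂, ?_⟩
  rw [concatCurve_of_ge h₂.1 (le_add_of_nonneg_right hT₂), add_sub_cancel_left]

/-- The reachable set as a submonoid of `SU(N)`: trajectories can be concatenated because the
control system is right invariant. -/
def reachableSubmonoid (A B : Matrix (Fin N) (Fin N) ℂ) :
    Submonoid (specialUnitaryGroup (Fin N) ℂ) where
  carrier := reachableSet A B
  mul_mem' := mul_mem_reachableSet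
  one_mem' := one_mem_reachableSet A B

theorem exp_smul_mem_reachableSubmonoid_map (v : ℝ) (hM : A + v • B ∈ suAlgebra (Fin N)) {t : ℝ}
    (ht : 0 ≤ t) : exp (t • (A + v • B)) ∈
      (reachableSubmonoid A B).map (specialUnitaryGroup (Fin N) ℂ).subtype := by
  let γ : ℝ → specialUnitaryGroup (Fin N) ℂ := fun s =>
    ⟨exp (s • (A + v • B)), exp_mem_specialUnitaryGroup ((suAlgebra (Fin N)).smul_mem s hM)⟩
  have hγ : Continuous γ :=
    Continuous.subtype_mk (continuous_iff_continuousAt.2 fun s =>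
      (hasDerivAt_exp_smul_const (A + v • B) s).continuousAt) _
  have hγ_zero : γ 0 = 1 := Subtype.ext (by simp [γ])
  exact ⟨γ t, ⟨t, ht, fun _ => v, γ, ⟨hγ_zero, hγ.continuousOn, ∅, fun s _ _ =>
    isRegularTime_exp_smul v (fun _ => rfl) s⟩, rfl⟩, rfl⟩

theorem isControllable_of_suAlgebra_le_lieSpan (hA : A ∈ suAlgebra (Fin N))
    (hB : B ∈ suAlgebra (Fin N))
    (hsu : suAlgebra (Fin N) ≤ LieSubalgebra.lieSpan ℝ (Matrix (Fin N) (Fin N) ℂ) {A, B}) :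
    IsControllable A B := by
  let 𝓜 : Set (Matrix (Fin N) (Fin N) ℂ) := Set.range fun v : ℝ => A + v • B
  have hA_mem : A ∈ LieSubalgebra.lieSpan ℝ _ 𝓜 :=
    LieSubalgebra.subset_lieSpan ⟨0, by simp⟩
  have hAB_mem : A + B ∈ LieSubalgebra.lieSpan ℝ _ 𝓜 :=
    LieSubalgebra.subset_lieSpan ⟨1, by simp⟩
  have hB_mem : B ∈ LieSubalgebra.lieSpan ℝ _ 𝓜 := by
    simpa only [add_sub_cancel_left] using sub_mem hAB_mem hA_mem
  have hpair : LieSubalgebra.lieSpan ℝ _ {A, B} ≤ LieSubalgebra.lieSpan ℝ _ 𝓜 :=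
    LieSubalgebra.lieSpan_le.2 (Set.pair_subset hA_mem hB_mem)
  have htop : reachableSubmonoid A B = ⊤ := by
    refine eq_top_of_suAlgebra_le_lieSpan (𝓜 := 𝓜) ?_ (hsu.trans hpair)
    rintro _ ⟨v, rfl⟩ t ht
    exact exp_smul_mem_reachableSubmonoid_map v
      ((suAlgebra (Fin N)).add_mem hA ((suAlgebra (Fin N)).smul_mem v hB)) ht
  exact Set.eq_univ_of_forall fun X => htop.ge (Submonoid.mem_top X)

end Control

theorem mainTheorem6_general {N : ℕ} {E : Fin N → ℝ} (hE_trace : ∑ k, E k = 0)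
    (hE : Function.Injective E) {B : Matrix (Fin N) (Fin N) ℂ} (hB : B ∈ su N)
    (hconn : (matrixGraph B).Connected) (hsep : SeparatesTransitions (fun k => (E k : ℂ)) B) :
    IsControllable (drift E) B :=
  isControllable_of_suAlgebra_le_lieSpan (drift_mem_suAlgebra hE_trace) hB
    (suAlgebra_le_lieSpan_pair hE_trace hE hB hconn hsep)

theorem mainTheorem6 (N : ℕ) (E : Fin N → ℝ) (hE_trace : ∑ k, E k = 0)
    (hE_order : Monotone E) (hE_nondegenerate : ∀ i j, i ≠ j → E i ≠ E j)
    (B : Matrix (Fin N) (Fin N) ℂ) (hB : B ∈ su N) (hconn : (matrixGraph B).Connected) :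
    (IsRegularDiag (diagPart B) → IsControllable (drift E) B) ∧
      (IsRegularAlong (diagPart B) ⁅drift E, B⁆ → IsControllable (drift E) B) := by
  have hE : Function.Injective E := fun i j h => by_contra fun hij => hE_nondegenerate i j hij h
  exact ⟨fun hreg => mainTheorem6_general hE_trace hE hB hconn (hreg.separatesTransitions _),
    fun hreg => mainTheorem6_general hE_trace hE hB hconn
      (hreg.separatesTransitions (hE_order.strictMono_of_injective hE) hB)⟩
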